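/- Let $\Sigma$ be a set of atoms. A body literal is $a$, $not\,a$ or $not\,not\,a$ with $a\in\Sigma$. A rule $r$ is a pair $H(r)\leftarrow B(r)$ of a finite set $H(r)\subseteq\Sigma$ of atoms (read disjunctively) and a finite set $B(r)$ of body literals (read conjunctively); write $B^+(r)$, $B^-(r)$, $B^{--}(r)$ for the sets of atoms $a$ such that $a$, respectively $not\,a$, $not\,not\,a$, is in $B(r)$. A program over $\Sigma$ is a finite set of rules. *Strong equivalence.* The reduct of $P$ given $I\subseteq\Sigma$ is $P^I=\{H(r)\leftarrow B^+(r) : r\in P,\ B^-(r)\cap I=\emptyset,\ B^{--}(r)\subseteq I\}$. A pair $\langle X,Y\rangle$ with $X\subseteq Y\subseteq\Sigma$ is an HT-model of $P$ if $Y\models P$ and $X\models P^Y$ classically. $Y$ is an answer set of $P$ if $\langle Y,Y\rangle$ is an HT-model of $P$ and no $\langle X,Y\rangle$ with $X\subsetneq Y$ is. Let $\mathcal{AS}(P)$ be the set of answer sets of $P$. Then $P_1\equiv P_2$ ($P_1$ and $P_2$ are strongly equivalent) if $\mathcal{AS}(P_1\cup R)=\mathcal{AS}(P_2\cup R)$ for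 every program $R$ over $\Sigma$. *Normal form.* $NF(P)$ is obtained from $P$ by (i) removing all rules $r$ with $H(r)\cap B^+(r)\ne\emptyset$, $B^+(r)\cap B^-(r)\neq\emptyset$ or $B^-(r)\cap B^{--}(r)\neq\emptyset$; (ii) in the remaining rules $r$, removing $not\,not\,a$ from $B(r)$ whenever $a\in B^+(r)$; (iii) removing $a$ from $H(r)$ whenever $a\in B^-(r)$; (iv) removing from the resulting program $P_3$ every rule $r$ for which some $r'\in P_3$ satisfies $H(r')\subseteq H(r)$ and $B(r')\subsetneq B(r)$, or $H(r')\subsetneq H(r)$ and $B(r')\subseteq B(r)$. *As-dual.* For a set $S$ of literals let $not(S)=\{not\,l: l\in S\}$ and $not\,not(S)=\{not\,not\,l:l\in S\}$, with the simplifications $not\,not\,not\,a=not\,a$ and $not\,not\,not\,not\,a=not\,not\,a$. Let $q\in\Sigma$, $B^{\setminus q}(r)=B(r)\setminus\{q,not\,q,not\,not\,q\}$ and $H^{\setminus q}(r)=H(r)\setminus\{q\}$. For a finite set $S$ of rules, $\mathcal D^q(S)$ is the set of all $$not(\{l_r: r\in F\})\cup not\,not(\{l_r: r\in T\})$$ where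 $S=F\cup T$, $F\cap T=\emptyset$ ($F$ and $T$ may be empty), $l_r\in B^{\setminus q}(r)$ for $r\in F$ and $l_r\in H^{\setminus q}(r)$ for $r\in T$. *The operator $f_{SP}$.* Let $P$ be a program over $\Sigma$, $q\in\Sigma$, $N=NF(P)$. Let $R$ be the set of rules of $N$ in which $q$ does not occur and $R_0=\{r\in N: q\in B(r)\}$, $R_1=\{r\in N: not\,q\in B(r)\}$, $R_2=\{r\in N: not\,not\,q\in B(r),\ q\notin H(r)\}$, $R_3=\{r\in N: not\,not\,q\in B(r),\ q\in H(r)\}$, $R_4=\{r\in N: not\,not\,q\notin B(r),\ q\in H(r)\}$. Then $f_{SP}(P,q)=NF(P'')$, where $P''$ consists of all rules in $R$ and the following rules: - **1a**, for $r_0\in R_0$, $r_4\in R_4$: $H(r_0)\cup H^{\setminus q}(r_4)\leftarrow B^{\setminus q}(r_0)\cup B(r_4)$; - **2a**, for $r_0\in R_0$, $r_3\in R_3$, $r'\in R_1\cup R_4$: $H(r_0)\cup H^{\setminus q}(r_3)\leftarrow B^{\setminus q}(r_0)\cup B^{\setminus q}(r_3)\cup not(H^{\setminus q}(r'))\cup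 not\,not(B^{\setminus q}(r'))$; - **3a**, for $r_0\in R_0$, $r_3\in R_3$, $h\in H(r_0)$, $D\in\mathcal D^q((R_0\cup R_2)\setminus\{r_0\})$: $H(r_0)\leftarrow B^{\setminus q}(r_0)\cup\{not\,not\,h\}\cup D\cup B^{\setminus q}(r_3)\cup not(H^{\setminus q}(r_3))$; - **1b**, for $r_2\in R_2$, $r_4\in R_4$: $H(r_2)\leftarrow B^{\setminus q}(r_2)\cup not(H^{\setminus q}(r_4))\cup not\,not(B(r_4))$; - **2b**, for $r_2\in R_2$, $r_3\in R_3$, $r'\in R_1\cup R_4$: $H(r_2)\leftarrow B^{\setminus q}(r_2)\cup not(H^{\setminus q}(r_3)\cup H^{\setminus q}(r'))\cup not\,not(B^{\setminus q}(r_3)\cup B^{\setminus q}(r'))$; - **3b**, for $r_2\in R_2$, $r_3\in R_3$, $h\in H(r_2)$, $D\in\mathcal D^q((R_0\cup R_2)\setminus\{r_2\})$: $H(r_2)\leftarrow B^{\setminus q}(r_2)\cup not(H^{\setminus q}(r_3))\cup not\,not(B^{\setminus q}(r_3)\cup\{h\})\cup D$; - **4**, for $r'\in R_1\cup R_4$,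 $D\in\mathcal D^q(R_3\cup R_4)$ with $D\cap not(B^{\setminus q}(r'))=\emptyset$: $H^{\setminus q}(r')\leftarrow B^{\setminus q}(r')\cup D$; - **5**, for $r'\in R_1\cup R_4$, $r_3\in R_3$, $r\in R_0\cup R_2$, $D\in\mathcal D^q(R_4)$ with $D\cap not(B^{\setminus q}(r'))=\emptyset$: $H^{\setminus q}(r')\leftarrow B^{\setminus q}(r')\cup not(H(r)\cup H^{\setminus q}(r_3))\cup not\,not(B^{\setminus q}(r)\cup B^{\setminus q}(r_3))\cup D$; - **6**, for $r'\in R_1\cup R_4$, $r_3\in R_3$, $h\in H^{\setminus q}(r')$, $D\in\mathcal D^q((R_1\cup R_4)\setminus\{r'\})$: $H^{\setminus q}(r')\leftarrow B^{\setminus q}(r')\cup not(H^{\setminus q}(r_3))\cup not\,not(B^{\setminus q}(r_3)\cup\{h\})\cup D$; - **7**, for $r_0\in R_0$, $r_3,r_3'\in R_3$ with $r_3\neq r_3'$, $h\in H(r_0)$, $D\in\mathcal D^q((R_0\cup R_2)\setminus\{r_0\})$: $H(r_0)\cup H^{\setminus q}(r_3)\leftarrow B^{\setminus q}(r_0)\cup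 B^{\setminus q}(r_3)\cup not(H^{\setminus q}(r_3'))\cup not\,not(B^{\setminus q}(r_3')\cup\{h\})\cup D$. **Proposition.** Let $P$ and $P'$ be programs over $\Sigma$ and $q\in\Sigma$. If $P\equiv P'$, then $f_{SP}(P,q)\equiv f_{SP}(P',q)$. -/

import Mathlib

namespace ASP

/-- Body literals over a signature `α`: an atom `a`, `not a`, or `not not a`. -/
inductive Lit (α : Type*) where
  | pos (a : α) : Lit α
  | neg (a : α) : Lit α
  | nneg (a : α) : Lit α
deriving DecidableEq

namespace Lit

variable {α : Type*}

/-- The atom occurring in a literal. -/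
def atom : Lit α → α
  | pos a => a
  | neg a => a
  | nneg a => a

/-- `not l`, where `not not not a` is simplified to `not a`. -/
def naf : Lit α → Lit α
  | pos a => neg a
  | neg a => nneg a
  | nneg a => neg a

/-- `not not l`, where `not not not a` is simplified to `not a` and
`not not not not a` to `not not a`. -/
def nafnaf : Lit α → Lit α
  | pos a => nneg a
  | neg a => neg a
  | nneg a => nneg a

/-- Classical truth of a literal in an interpretation. -/
def Holds (I : Set α) : Lit α → Prop
  | pos a => a ∈ I
  | neg a => a ∉ I
  | nneg a => a ∈ I

end Lit

/-- A rule `head ← body`: a disjunction of atoms in the head, a conjunction of literals in the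
body. -/
@[ext]
structure Rule (α : Type*) where
  head : Finset α
  body : Finset (Lit α)
deriving DecidableEq

/-- An extended logic program over the signature `α`: a finite set of rules. -/
abbrev Program (α : Type*) := Finset (Rule α)

section Semantics

variable {α : Type*}

/-- Classical satisfaction of a rule. -/
def Rule.Sat (I : Set α) (r : Rule α) : Prop :=
  (∀ l ∈ r.body, l.Holds I) → ∃ a ∈ r.head, a ∈ I

/-- `I` is a classical model of a set of rules. -/
def Models (I : Set α) (P : Set (Rule α)) : Prop :=
  ∀ r ∈ P, r.Sat I

/-- The reduct of `P` given `I`: the rules `H(r) ← B⁺(r)` for those `r ∈ P` such that no `c` with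
`not c` in the body of `r` is in `I`, and all `d` with `not not d` in the body of `r` are in `I`. -/
def reduct (P : Set (Rule α)) (I : Set α) : Set (Rule α) :=
  {r' | ∃ r ∈ P, (∀ c, Lit.neg c ∈ r.body → c ∉ I) ∧ (∀ d, Lit.nneg d ∈ r.body → d ∈ I) ∧
    r'.head = r.head ∧ ∀ l, l ∈ r'.body ↔ l ∈ r.body ∧ ∃ b, l = Lit.pos b}

/-- `⟨X, Y⟩` is an HT-model of `P`. -/
def IsHTModel (P : Program α) (X Y : Set α) : Prop :=
  X ⊆ Y ∧ Models Y (P : Set (Rule α)) ∧ Models X (reduct (P : Set (Rule α)) Y)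

/-- The set of answer sets of `P`. -/
def answerSets (P : Program α) : Set (Set α) :=
  {Y | IsHTModel P Y Y ∧ ¬ ∃ X, X ⊂ Y ∧ IsHTModel P X Y}

variable [DecidableEq α]

/-- Strong equivalence: the same answer sets, whatever program is added. -/
def StronglyEquivalent (P₁ P₂ : Program α) : Prop :=
  ∀ R : Program α, answerSets (P₁ ∪ R) = answerSets (P₂ ∪ R)

end Semantics

section NormalForm

variable {α : Type*} [DecidableEq α]

/-- The atoms occurring in a rule. -/
def Rule.atoms (r : Rule α) : Finset α :=
  r.head ∪ r.body.image Lit.atom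

/-- A rule is tautological if some atom is both in the head and positively in the body, or both
positive and negated in the body, or both negated and doubly negated in the body. -/
def Rule.Tautological (r : Rule α) : Prop :=
  (∃ a ∈ r.head, Lit.pos a ∈ r.body) ∨
  (∃ a ∈ r.atoms, Lit.pos a ∈ r.body ∧ Lit.neg a ∈ r.body) ∨
  (∃ a ∈ r.atoms, Lit.neg a ∈ r.body ∧ Lit.nneg a ∈ r.body)

instance (r : Rule α) : Decidable r.Tautological := by
  unfold Rule.Tautological; infer_instance

/-- Remove `not not a` from the body whenever `a` is in the body. -/
def Rule.dropDoubleNeg (r : Rule α) : Rule α :=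
  ⟨r.head, r.body.filter fun l => ¬ (l = Lit.nneg l.atom ∧ Lit.pos l.atom ∈ r.body)⟩

/-- Remove `a` from the head whenever `not a` is in the body. -/
def Rule.dropHead (r : Rule α) : Rule α :=
  ⟨r.head.filter fun a => Lit.neg a ∉ r.body, r.body⟩

/-- `r` is minimal in `P`. -/
def Rule.MinimalIn (P : Program α) (r : Rule α) : Prop :=
  ¬ ∃ r' ∈ P, (r'.head ⊆ r.head ∧ r'.body ⊂ r.body) ∨ (r'.head ⊂ r.head ∧ r'.body ⊆ r.body)

instance (P : Program α) (r : Rule α) : Decidable (r.MinimalIn P) := by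
  unfold Rule.MinimalIn; infer_instance

/-- The normal form of a program: remove tautological rules, then redundant double negations, then
redundant head atoms, and finally all rules that are not minimal in the resulting program. -/
def normalForm (P : Program α) : Program α :=
  let P₁ := P.filter fun r => ¬ r.Tautological
  let P₂ := P₁.image Rule.dropDoubleNeg
  let P₃ := P₂.image Rule.dropHead
  P₃.filter fun r => r.MinimalIn P₃

end NormalForm

section Forgetting

variable {α : Type*} [DecidableEq α]

/-- `not(S)` for a set `S` of literals. -/
def nafSet (S : Finset (Lit α)) : Finset (Lit α) := S.image Lit.naf

/-- `not not(S)` for a set `S` of literals. -/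
def nafnafSet (S : Finset (Lit α)) : Finset (Lit α) := S.image Lit.nafnaf

/-- A set of atoms, seen as a set of literals. -/
def lits (A : Finset α) : Finset (Lit α) := A.image Lit.pos

/-- The body of `r` without `q`, `not q` and `not not q`. -/
def Rule.bodyWo (q : α) (r : Rule α) : Finset (Lit α) :=
  r.body \ {Lit.pos q, Lit.neg q, Lit.nneg q}

/-- The head of `r` without `q`. -/
def Rule.headWo (q : α) (r : Rule α) : Finset α :=
  r.head \ {q}

/-- The as-dual of a set `S` of rules with respect to `q`: for every partition of `S` into (possibly
empty) parts `F` and `T = S \ F`, every choice `b` of one body literal of each rule in `F` and every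
choice `h` of one head atom of each rule in `T` (none of them on `q`), the set of all negations
`not b(r)`, `r ∈ F`, and all double negations `not not h(r)`, `r ∈ T`. -/
def asDual (q : α) (S : Program α) : Finset (Finset (Lit α)) :=
  S.powerset.biUnion fun F =>
    (F.pi fun r => r.bodyWo q).biUnion fun b =>
      ((S \ F).pi fun r => r.headWo q).image fun h =>
        nafSet (F.attach.image fun r => b r.1 r.2) ∪
          nafnafSet (lits ((S \ F).attach.image fun r => h r.1 r.2))

/-- Rules that do not mention `q`. -/
def clsR (q : α) (P : Program α) : Program α :=
  P.filter fun r => q ∉ r.atoms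

/-- Rules with `q` in the body. -/
def clsR0 (q : α) (P : Program α) : Program α :=
  P.filter fun r => Lit.pos q ∈ r.body

/-- Rules with `not q` in the body. -/
def clsR1 (q : α) (P : Program α) : Program α :=
  P.filter fun r => Lit.neg q ∈ r.body

/-- Rules with `not not q` in the body and `q` not in the head. -/
def clsR2 (q : α) (P : Program α) : Program α :=
  P.filter fun r => Lit.nneg q ∈ r.body ∧ q ∉ r.head

/-- Rules with `not not q` in the body and `q` in the head (self-cycles on `q`). -/
def clsR3 (q : α) (P : Program α) : Program α :=
  P.filter fun r => Lit.nneg q ∈ r.body ∧ q ∈ r.head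

/-- Rules with `not not q` not in the body and `q` in the head. -/
def clsR4 (q : α) (P : Program α) : Program α :=
  P.filter fun r => Lit.nneg q ∉ r.body ∧ q ∈ r.head

/-- Rules (1a): replace `q` in the body of `r₀` by the body of `r₄`. Here and below `N` is a program in
normal form. -/
def derive1a (q : α) (N : Program α) : Program α :=
  (clsR0 q N).biUnion fun r₀ => (clsR4 q N).image fun r₄ =>
    ⟨r₀.head ∪ r₄.headWo q, r₀.bodyWo q ∪ r₄.body⟩

/-- Rules (2a), one for each rule `r'` supported by `not q`. -/
def derive2a (q : α) (N : Program α) : Program α :=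
  (clsR0 q N).biUnion fun r₀ => (clsR3 q N).biUnion fun r₃ =>
    (clsR1 q N ∪ clsR4 q N).image fun r' =>
      ⟨r₀.head ∪ r₃.headWo q,
        r₀.bodyWo q ∪ r₃.bodyWo q ∪ nafSet (lits (r'.headWo q)) ∪ nafnafSet (r'.bodyWo q)⟩

/-- Rules (3a): cyclic support transferred from `q` to a head atom `h` of `r₀`. -/
def derive3a (q : α) (N : Program α) : Program α :=
  (clsR0 q N).biUnion fun r₀ => (clsR3 q N).biUnion fun r₃ =>
    r₀.head.biUnion fun h => (asDual q ((clsR0 q N ∪ clsR2 q N) \ {r₀})).image fun D =>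
      ⟨r₀.head,
        r₀.bodyWo q ∪ {Lit.nneg h} ∪ D ∪ r₃.bodyWo q ∪ nafSet (lits (r₃.headWo q))⟩

/-- Rules (1b): replace `not not q` in the body of `r₂`. -/
def derive1b (q : α) (N : Program α) : Program α :=
  (clsR2 q N).biUnion fun r₂ => (clsR4 q N).image fun r₄ =>
    ⟨r₂.head, r₂.bodyWo q ∪ nafSet (lits (r₄.headWo q)) ∪ nafnafSet r₄.body⟩

/-- Rules (2b), one for each rule `r'` supported by `not q`. -/
def derive2b (q : α) (N : Program α) : Program α :=
  (clsR2 q N).biUnion fun r₂ => (clsR3 q N).biUnion fun r₃ =>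
    (clsR1 q N ∪ clsR4 q N).image fun r' =>
      ⟨r₂.head,
        r₂.bodyWo q ∪ nafSet (lits (r₃.headWo q ∪ r'.headWo q)) ∪
          nafnafSet (r₃.bodyWo q ∪ r'.bodyWo q)⟩

/-- Rules (3b): cyclic support transferred from `q` to a head atom `h` of `r₂`. -/
def derive3b (q : α) (N : Program α) : Program α :=
  (clsR2 q N).biUnion fun r₂ => (clsR3 q N).biUnion fun r₃ =>
    r₂.head.biUnion fun h => (asDual q ((clsR0 q N ∪ clsR2 q N) \ {r₂})).image fun D =>
      ⟨r₂.head,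
        r₂.bodyWo q ∪ nafSet (lits (r₃.headWo q)) ∪
          nafnafSet (r₃.bodyWo q ∪ {Lit.pos h}) ∪ D⟩

/-- Rules (4): `not q` replaced by the elements of the as-dual. -/
def derive4 (q : α) (N : Program α) : Program α :=
  (clsR1 q N ∪ clsR4 q N).biUnion fun r' =>
    ((asDual q (clsR3 q N ∪ clsR4 q N)).filter fun D => D ∩ nafSet (r'.bodyWo q) = ∅).image
      fun D => ⟨r'.headWo q, r'.bodyWo q ∪ D⟩

/-- Rules (5), one for each rule `r` supported by `q`. -/
def derive5 (q : α) (N : Program α) : Program α :=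
  (clsR1 q N ∪ clsR4 q N).biUnion fun r' => (clsR3 q N).biUnion fun r₃ =>
    (clsR0 q N ∪ clsR2 q N).biUnion fun r =>
      ((asDual q (clsR4 q N)).filter fun D => D ∩ nafSet (r'.bodyWo q) = ∅).image
        fun D =>
          ⟨r'.headWo q,
            r'.bodyWo q ∪ nafSet (lits (r.head ∪ r₃.headWo q)) ∪
              nafnafSet (r.bodyWo q ∪ r₃.bodyWo q) ∪ D⟩

/-- Rules (6): cyclic support transferred to a head atom `h` of `r'` other than `q`. -/
def derive6 (q : α) (N : Program α) : Program α :=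
  (clsR1 q N ∪ clsR4 q N).biUnion fun r' => (clsR3 q N).biUnion fun r₃ =>
    (r'.headWo q).biUnion fun h =>
      (asDual q ((clsR1 q N ∪ clsR4 q N) \ {r'})).image fun D =>
        ⟨r'.headWo q,
          r'.bodyWo q ∪ nafSet (lits (r₃.headWo q)) ∪
            nafnafSet (r₃.bodyWo q ∪ {Lit.pos h}) ∪ D⟩

/-- Rules (7): connect two distinct self-cycles `r₃`, `r₃'` on `q`. -/
def derive7 (q : α) (N : Program α) : Program α :=
  (clsR0 q N).biUnion fun r₀ => (clsR3 q N).biUnion fun r₃ =>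
    (clsR3 q N \ {r₃}).biUnion fun r₃' => r₀.head.biUnion fun h =>
      (asDual q ((clsR0 q N ∪ clsR2 q N) \ {r₀})).image fun D =>
        ⟨r₀.head ∪ r₃.headWo q,
          r₀.bodyWo q ∪ r₃.bodyWo q ∪ nafSet (lits (r₃'.headWo q)) ∪
            nafnafSet (r₃'.bodyWo q ∪ {Lit.pos h}) ∪ D⟩

/-- The result `f_SP(P, q)` of forgetting about the atom `q` from the program `P`. -/
def forgetSP (P : Program α) (q : α) : Program α :=
  let N := normalForm P
  normalForm
    (clsR q N ∪ derive1a q N ∪ derive2a q N ∪ derive3a q N ∪ derive1b q N ∪ derive2b q N ∪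
      derive3b q N ∪ derive4 q N ∪ derive5 q N ∪ derive6 q N ∪ derive7 q N)

end Forgetting

end ASP

/-! Strong equivalence of programs amounts to having the same HT-models (`stronglyEquivalent_iff`).
So it suffices to show that the HT-models of `forgetSP P q` are determined by those of `P`, although
its construction is syntactic. This is `isHTModel_forgetSP`, whose right-hand side mentions `P` only
through `IsHTModel P`.

To prove it, note that passing to the normal form keeps the HT-models and leaves `q` in so few
positions per rule that each rule not free of `q` falls under one of the classes `clsR0` to `clsR4`.
Once `q` is stripped from the rules, everything about a pair `⟨X, Y⟩` is recorded by twelve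
propositions: for each of the six classes, whether a stripped rule is violated in `⟨X, Y⟩` and
whether one is violated in `⟨Y, Y⟩`.

Two computations are made in these terms. Being an HT-model of `P` with `q` in neither component,
only in the second, or in both depends on the classes that remain active for that choice
(`violated_sdiff_sdiff`, `violated_sdiff_insert`, `violated_insert_insert`). Each family of derived
rules is violated exactly when a certain conjunction of such propositions holds, because negated
literals test `Y` alone and the as-dual expresses "no stripped rule of the class is violated in
`Y`". Only `derive3a` and `derive7` do not factor separately, but their disjunction does. The
claimed description is then a propositional equivalence. -/

namespace ASP

/-! ### Satisfaction in here-and-there interpretations. -/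

section HereAndThere

variable {α : Type*}

/-- Truth of a literal in the here-and-there interpretation `⟨X, Y⟩`. -/
def Lit.HoldsHT (X Y : Set α) : Lit α → Prop
  | pos a => a ∈ X
  | neg a => a ∉ Y
  | nneg a => a ∈ Y

/-- Truth of a conjunction of literals in the here-and-there interpretation `⟨X, Y⟩`. -/
def BodyHolds (X Y : Set α) (B : Finset (Lit α)) : Prop :=
  ∀ l ∈ B, l.HoldsHT X Y

/-- The rule `r` is violated in `⟨X, Y⟩`: its body holds, and no head atom is in `X`. -/
def Rule.Viol (X Y : Set α) (r : Rule α) : Prop :=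
  BodyHolds X Y r.body ∧ ∀ a ∈ r.head, a ∉ X

/-- Some rule of `P` is violated in `⟨X, Y⟩`. -/
def Violated (X Y : Set α) (P : Program α) : Prop :=
  ∃ r ∈ P, r.Viol X Y

theorem Lit.holdsHT_self (Y : Set α) (l : Lit α) : l.HoldsHT Y Y ↔ l.Holds Y := by
  cases l <;> rfl

theorem Lit.HoldsHT.mono {X X' Y : Set α} (h : X ⊆ X') {l : Lit α} (hl : l.HoldsHT X Y) :
    l.HoldsHT X' Y := by
  cases l
  exacts [h hl, hl, hl]

theorem Rule.sat_iff_not_viol (Y : Set α) (r : Rule α) : r.Sat Y ↔ ¬ r.Viol Y Y := by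
  simp [Rule.Sat, Rule.Viol, BodyHolds, Lit.holdsHT_self]

/-- A rule survives in the reduct precisely when its negated and doubly negated literals are true in
`Y`; what remains of its body is evaluated in `X`. Thus the reduct can be replaced by evaluating
literals in `⟨X, Y⟩`. -/
theorem models_reduct_iff (P : Program α) (X Y : Set α) :
    Models X (reduct (P : Set (Rule α)) Y) ↔ ¬ Violated X Y P := by
  classical
  constructor
  · rintro h ⟨r, hr, hb, hh⟩
    obtain ⟨a, ha, haX⟩ := h ⟨r.head, r.body.filter fun l => ∃ b, l = Lit.pos b⟩
      ⟨r, hr, fun c hc => hb _ hc, fun d hd => hb _ hd, rfl, fun l => by simp⟩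
      (fun l hl => by
        obtain ⟨hl, b, rfl⟩ := Finset.mem_filter.1 hl
        exact hb _ hl)
    exact hh a ha haX
  · rintro h r' ⟨r, hr, hn, hnn, hh, hb⟩ hbody
    by_contra hc
    refine h ⟨r, hr, fun l hl => ?_, fun a ha haX => hc ⟨a, hh ▸ ha, haX⟩⟩
    cases l with
    | pos a => exact hbody _ ((hb _).2 ⟨hl, a, rfl⟩)
    | neg a => exact hn a hl
    | nneg a => exact hnn a hl

theorem isHTModel_iff (P : Program α) (X Y : Set α) :
    IsHTModel P X Y ↔ X ⊆ Y ∧ ¬ Violated Y Y P ∧ ¬ Violated X Y P := by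
  rw [IsHTModel, models_reduct_iff]
  simp [Models, Violated, Rule.sat_iff_not_viol]

theorem isHTModel_self_iff (P : Program α) (Y : Set α) :
    IsHTModel P Y Y ↔ ¬ Violated Y Y P := by
  simp [isHTModel_iff]

variable [DecidableEq α]

theorem violated_union (X Y : Set α) (P Q : Program α) :
    Violated X Y (P ∪ Q) ↔ Violated X Y P ∨ Violated X Y Q := by
  simp only [Violated, Finset.mem_union]
  grind

theorem isHTModel_union (P Q : Program α) (X Y : Set α) :
    IsHTModel (P ∪ Q) X Y ↔ IsHTModel P X Y ∧ IsHTModel Q X Y := by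
  simp only [isHTModel_iff, violated_union]
  tauto

theorem bodyHolds_union (X Y : Set α) (A B : Finset (Lit α)) :
    BodyHolds X Y (A ∪ B) ↔ BodyHolds X Y A ∧ BodyHolds X Y B := by
  simp only [BodyHolds, Finset.mem_union]
  grind

omit [DecidableEq α] in
theorem Lit.holdsHT_congr {X Y X' Y' : Set α} {l : Lit α}
    (hX : l.atom ∈ X ↔ l.atom ∈ X') (hY : l.atom ∈ Y ↔ l.atom ∈ Y') :
    l.HoldsHT X Y ↔ l.HoldsHT X' Y' := by
  cases l
  exacts [hX, not_congr hY, hY]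

theorem Rule.viol_congr {X Y X' Y' : Set α} {r : Rule α}
    (hX : ∀ a ∈ r.atoms, a ∈ X ↔ a ∈ X') (hY : ∀ a ∈ r.atoms, a ∈ Y ↔ a ∈ Y') :
    r.Viol X Y ↔ r.Viol X' Y' := by
  have hb : ∀ l ∈ r.body, l.atom ∈ r.atoms := fun l hl =>
    Finset.mem_union_right _ (Finset.mem_image_of_mem _ hl)
  refine and_congr (forall₂_congr fun l hl =>
    Lit.holdsHT_congr (hX _ (hb l hl)) (hY _ (hb l hl))) (forall₂_congr fun a ha =>
      not_congr (hX a (Finset.mem_union_left _ ha)))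

/-- Satisfaction depends only on the atoms that occur. -/
theorem violated_inter {P : Program α} {A : Set α} (hA : ∀ r ∈ P, ∀ a ∈ r.atoms, a ∈ A)
    (X Y : Set α) : Violated (X ∩ A) (Y ∩ A) P ↔ Violated X Y P := by
  refine exists_congr fun r => and_congr_right fun hr => Rule.viol_congr ?_ ?_ <;>
  · intro a ha
    simp [hA r hr a ha]

/-! ### Test programs, and strong equivalence as equality of HT-models. -/

/-- The facts `a ←` for `a ∈ F`. -/
def facts (F : Finset α) : Program α := F.image fun a => ⟨{a}, ∅⟩

/-- The rules `a ← b` for `a, b ∈ F`. -/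
def cycles (F : Finset α) : Program α :=
  F.biUnion fun a => F.image fun b => ⟨{a}, {Lit.pos b}⟩

theorem violated_facts (F : Finset α) (X Y : Set α) :
    Violated X Y (facts F) ↔ ¬ (F : Set α) ⊆ X := by
  simp [Violated, facts, Rule.Viol, BodyHolds, Set.not_subset]

theorem violated_cycles (F : Finset α) (X Y : Set α) :
    Violated X Y (cycles F) ↔ ∃ a ∈ F, ∃ b ∈ F, b ∈ X ∧ a ∉ X := by
  simp only [Violated, cycles, Finset.mem_biUnion, Finset.mem_image]
  constructor
  · rintro ⟨r, ⟨a, ha, b, hb, rfl⟩, h, h'⟩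
    exact ⟨a, ha, b, hb, h (Lit.pos b) (by simp), h' a (by simp)⟩
  · rintro ⟨a, ha, b, hb, hbX, haX⟩
    exact ⟨_, ⟨a, ha, b, hb, rfl⟩, by
      simpa [BodyHolds, Lit.HoldsHT] using hbX, by simpa using haX⟩

theorem StronglyEquivalent.symm {P Q : Program α} (h : StronglyEquivalent P Q) :
    StronglyEquivalent Q P := fun R => (h R).symm

/-- With the facts `Y` added, no proper subset of `Y` can compete, so `Y` is an answer set as soon
as it is a model. -/
theorem StronglyEquivalent.isHTModel_self_of_finite {P Q : Program α}
    (h : StronglyEquivalent P Q) (Y : Finset α) (hP : IsHTModel P Y Y) : IsHTModel Q Y Y := by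
  have hY : (Y : Set α) ∈ answerSets (P ∪ facts Y) := by
    refine ⟨(isHTModel_union _ _ _ _).2 ⟨hP, ?_⟩, ?_⟩
    · simp [isHTModel_self_iff, violated_facts]
    · rintro ⟨X, hX, hm⟩
      rw [isHTModel_union, isHTModel_iff (facts Y), violated_facts, violated_facts] at hm
      exact hX.2 (not_not.1 hm.2.2.2)
  rw [h] at hY
  exact ((isHTModel_union _ _ _ _).1 hY.1).1

/-- The context consisting of the facts `X` and the cycles on `Y \ X` leaves `X` as the only proper
subset of `Y` that could refute `Y`. If `⟨X, Y⟩` is an HT-model of `P` but not of `Q`, then `Y` is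
an answer set in this context for `Q` but not for `P`. -/
theorem StronglyEquivalent.isHTModel_of_finite {P Q : Program α}
    (h : StronglyEquivalent P Q) (X Y : Finset α) (hP : IsHTModel P X Y) : IsHTModel Q X Y := by
  have hXY : (X : Set α) ⊆ Y := ((isHTModel_iff _ _ _).1 hP).1
  have hPY : IsHTModel P Y Y :=
    (isHTModel_self_iff _ _).2 ((isHTModel_iff _ _ _).1 hP).2.1
  have hQY := h.isHTModel_self_of_finite Y hPY
  by_contra hQ
  have hne : (X : Set α) ≠ Y := fun e => hQ (e ▸ hQY)
  have hY : (Y : Set α) ∈ answerSets (Q ∪ (facts X ∪ cycles (Y \ X))) := by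
    refine ⟨?_, ?_⟩
    · rw [isHTModel_union, isHTModel_union, isHTModel_self_iff (facts X),
        isHTModel_self_iff (cycles _), violated_facts, violated_cycles]
      refine ⟨hQY, not_not.2 hXY, ?_⟩
      rintro ⟨a, ha, b, -, -, haY⟩
      exact haY (Finset.mem_sdiff.1 ha).1
    · rintro ⟨Z, hZ, hm⟩
      rw [isHTModel_union, isHTModel_union, isHTModel_iff (facts X), isHTModel_iff (cycles _),
        violated_facts, violated_facts, violated_cycles, violated_cycles] at hm
      obtain ⟨hm, ⟨-, -, hXZ⟩, -, -, hc⟩ := hm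
      rw [not_not] at hXZ
      obtain ⟨a, haY, haZ⟩ := Set.exists_of_ssubset hZ
      have haX : a ∈ Y \ X := Finset.mem_sdiff.2 ⟨haY, fun ha => haZ (hXZ ha)⟩
      -- The cycles force `Z` to contain all of `Y \ X` or none of it, and `Z` misses `a`.
      have hZX : Z = X := by
        refine Set.Subset.antisymm (fun b hb => ?_) hXZ
        by_contra hbX
        exact hc ⟨a, haX, b, Finset.mem_sdiff.2 ⟨hZ.1 hb, hbX⟩, hb, haZ⟩
      exact hQ (hZX ▸ hm)
  rw [← h] at hY
  refine hY.2 ⟨X, hXY.ssubset_of_ne hne, ?_⟩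
  rw [isHTModel_union, isHTModel_union, isHTModel_iff (facts X), isHTModel_iff (cycles _),
    violated_facts, violated_facts, violated_cycles, violated_cycles]
  refine ⟨hP, ⟨hXY, not_not.2 hXY, not_not.2 subset_rfl⟩, hXY, ?_, ?_⟩
  · rintro ⟨a, ha, b, -, -, haY⟩
    exact haY (Finset.mem_sdiff.1 ha).1
  · rintro ⟨a, -, b, hb, hbX, -⟩
    exact (Finset.mem_sdiff.1 hb).2 hbX

/-- The test programs need finite sets, so `X` and `Y` are cut down to the finitely many atoms
occurring in `P` or `Q`, which changes no satisfaction. -/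
theorem StronglyEquivalent.isHTModel_imp {P Q : Program α}
    (h : StronglyEquivalent P Q) {X Y : Set α} (hP : IsHTModel P X Y) : IsHTModel Q X Y := by
  classical
  set A : Finset α := (P ∪ Q).biUnion Rule.atoms
  have hAP : ∀ r ∈ P, ∀ a ∈ r.atoms, a ∈ (A : Set α) := fun r hr a ha =>
    Finset.mem_biUnion.2 ⟨r, Finset.mem_union_left _ hr, ha⟩
  have hAQ : ∀ r ∈ Q, ∀ a ∈ r.atoms, a ∈ (A : Set α) := fun r hr a ha =>
    Finset.mem_biUnion.2 ⟨r, Finset.mem_union_right _ hr, ha⟩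
  rw [isHTModel_iff] at hP ⊢
  have hX : ((A.filter (· ∈ X) : Finset α) : Set α) = X ∩ A := by
    ext; simp [and_comm]
  have hY : ((A.filter (· ∈ Y) : Finset α) : Set α) = Y ∩ A := by
    ext; simp [and_comm]
  have := h.isHTModel_of_finite (A.filter (· ∈ X)) (A.filter (· ∈ Y)) (by
    rw [isHTModel_iff, hX, hY, violated_inter hAP, violated_inter hAP]
    exact ⟨Set.inter_subset_inter_left _ hP.1, hP.2⟩)
  rw [isHTModel_iff, hX, hY, violated_inter hAQ, violated_inter hAQ] at this
  exact ⟨hP.1, this.2⟩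

/-- Strong equivalence is equality of HT-models. -/
theorem stronglyEquivalent_iff {P Q : Program α} :
    StronglyEquivalent P Q ↔ ∀ X Y, IsHTModel P X Y ↔ IsHTModel Q X Y := by
  refine ⟨fun h X Y => ⟨h.isHTModel_imp, h.symm.isHTModel_imp⟩, fun h R => ?_⟩
  ext Y
  simp only [answerSets, Set.mem_ofPred_eq, isHTModel_union, h]

end HereAndThere

/-! ### The normal form: preservation of HT-models and its shape at `q`. -/

section NormalFormSemantics

variable {α : Type*} [DecidableEq α]

theorem Rule.Tautological.not_viol {r : Rule α} (h : r.Tautological) {X Y : Set α}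
    (hXY : X ⊆ Y) : ¬ r.Viol X Y := by
  rintro ⟨hb, hh⟩
  rcases h with ⟨a, ha, hp⟩ | ⟨a, -, hp, hn⟩ | ⟨a, -, hn, hnn⟩
  · exact hh a ha (hb _ hp)
  · exact hb _ hn (hXY (hb _ hp))
  · exact hb _ hn (hb _ hnn)

theorem Rule.viol_dropDoubleNeg {r : Rule α} {X Y : Set α} (hXY : X ⊆ Y) :
    r.dropDoubleNeg.Viol X Y ↔ r.Viol X Y := by
  refine and_congr_left fun _ => ⟨fun h l hl => ?_, fun h l hl => h l (Finset.mem_filter.1 hl).1⟩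
  by_cases hc : l = Lit.nneg l.atom ∧ Lit.pos l.atom ∈ r.body
  · rw [hc.1]
    exact hXY (h (Lit.pos l.atom) (Finset.mem_filter.2 ⟨hc.2, by simp⟩))
  · exact h l (Finset.mem_filter.2 ⟨hl, hc⟩)

theorem Rule.viol_dropHead {r : Rule α} {X Y : Set α} (hXY : X ⊆ Y) :
    r.dropHead.Viol X Y ↔ r.Viol X Y := by
  refine and_congr_right fun hb => ⟨fun h a ha haX => ?_,
    fun h a ha => h a (Finset.mem_filter.1 ha).1⟩
  by_cases hc : Lit.neg a ∈ r.body
  · exact hb _ hc (hXY haX)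
  · exact h a (Finset.mem_filter.2 ⟨ha, hc⟩) haX

/-- Descent on the total size of head and body. The minimal rule found subsumes `r`, so it is
violated whenever `r` is. -/
theorem Rule.exists_minimalIn {P : Program α} {r : Rule α} (hr : r ∈ P) :
    ∃ r' ∈ P, r'.MinimalIn P ∧ r'.head ⊆ r.head ∧ r'.body ⊆ r.body := by
  induction hn : r.head.card + r.body.card using Nat.strong_induction_on generalizing r with
  | _ n ih =>
    by_cases hm : r.MinimalIn P
    · exact ⟨r, hr, hm, subset_rfl, subset_rfl⟩
    · obtain ⟨s, hs, h⟩ := not_not.1 hm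
      have hsub : s.head ⊆ r.head ∧ s.body ⊆ r.body := by
        rcases h with h | h
        exacts [⟨h.1, h.2.1⟩, ⟨h.1.1, h.2⟩]
      have hlt : s.head.card + s.body.card < n := by
        rcases h with h | h
        · have := Finset.card_le_card h.1
          have := Finset.card_lt_card h.2
          omega
        · have := Finset.card_lt_card h.1
          have := Finset.card_le_card h.2
          omega
      obtain ⟨t, ht, htm, hth, htb⟩ := ih _ hlt hs rfl
      exact ⟨t, ht, htm, hth.trans hsub.1, htb.trans hsub.2⟩

theorem violated_normalForm (P : Program α) {X Y : Set α} (hXY : X ⊆ Y) :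
    Violated X Y (normalForm P) ↔ Violated X Y P := by
  simp only [Violated, normalForm]
  constructor
  · rintro ⟨r, hr, hv⟩
    simp only [Finset.mem_filter, Finset.mem_image] at hr
    obtain ⟨⟨_, ⟨s, hs, rfl⟩, rfl⟩, -⟩ := hr
    rw [Rule.viol_dropHead hXY, Rule.viol_dropDoubleNeg hXY] at hv
    exact ⟨s, hs.1, hv⟩
  · rintro ⟨r, hr, hv⟩
    have ht : ¬ r.Tautological := fun ht => ht.not_viol hXY hv
    rw [← Rule.viol_dropDoubleNeg hXY, ← Rule.viol_dropHead hXY] at hv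
    have hr' : r ∈ P.filter fun r => ¬ r.Tautological := Finset.mem_filter.2 ⟨hr, ht⟩
    obtain ⟨s, hs, hm, hh, hb⟩ := Rule.exists_minimalIn (Finset.mem_image_of_mem Rule.dropHead
      (Finset.mem_image_of_mem Rule.dropDoubleNeg hr'))
    exact ⟨s, Finset.mem_filter.2 ⟨hs, hm⟩, fun l hl => hv.1 l (hb hl),
      fun a ha => hv.2 a (hh ha)⟩

theorem isHTModel_normalForm (P : Program α) (X Y : Set α) :
    IsHTModel (normalForm P) X Y ↔ IsHTModel P X Y := by
  simp only [isHTModel_iff]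
  refine and_congr_right fun h => ?_
  rw [violated_normalForm P subset_rfl, violated_normalForm P h]

/-- In the rule `r`, the atom `q` occurs at most once, except possibly in the head and doubly
negated in the body. -/
structure Rule.Clean (q : α) (r : Rule α) : Prop where
  head_pos : q ∈ r.head → Lit.pos q ∉ r.body
  head_neg : q ∈ r.head → Lit.neg q ∉ r.body
  pos_neg : Lit.pos q ∈ r.body → Lit.neg q ∉ r.body
  pos_nneg : Lit.pos q ∈ r.body → Lit.nneg q ∉ r.body
  neg_nneg : Lit.neg q ∈ r.body → Lit.nneg q ∉ r.body

theorem Rule.mem_body_dropDoubleNeg {r : Rule α} {l : Lit α} :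
    l ∈ r.dropDoubleNeg.body ↔ l ∈ r.body ∧ ¬ (l = Lit.nneg l.atom ∧ Lit.pos l.atom ∈ r.body) :=
  Finset.mem_filter

theorem Rule.mem_head_dropHead {r : Rule α} {a : α} :
    a ∈ r.dropHead.head ↔ a ∈ r.head ∧ Lit.neg a ∉ r.body :=
  Finset.mem_filter

/-- Removing tautologies gives `head_pos`, `pos_neg` and `neg_nneg`; `dropHead` gives `head_neg`,
and `dropDoubleNeg` gives `pos_nneg`. -/
theorem Rule.clean_of_mem_normalForm {P : Program α} {r : Rule α} (hr : r ∈ normalForm P)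
    (q : α) : r.Clean q := by
  simp only [normalForm, Finset.mem_filter, Finset.mem_image] at hr
  obtain ⟨⟨_, ⟨s, ⟨-, hs⟩, rfl⟩, rfl⟩, -⟩ := hr
  simp only [Rule.Tautological, Rule.atoms, Finset.mem_union, Finset.mem_image, not_or,
    not_exists, not_and] at hs
  obtain ⟨h1, h2, h3⟩ := hs
  have hb : s.dropDoubleNeg.dropHead.body = s.dropDoubleNeg.body := rfl
  constructor <;> simp only [Rule.mem_head_dropHead, hb, Rule.mem_body_dropDoubleNeg]
  · exact fun h h' => h1 q h.1 h'.1
  · exact fun h => h.2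
  · exact fun h h' => h2 q (Or.inr ⟨_, h.1, rfl⟩) h.1 h'.1
  · exact fun h h' => h'.2 ⟨rfl, h.1⟩
  · exact fun h h' => h3 q (Or.inr ⟨_, h.1, rfl⟩) h.1 h'.1

end NormalFormSemantics

/-! ### Stripping `q` from rules, and the classes active for each placement of `q`. -/

section ForgettingSemantics

variable {α : Type*} [DecidableEq α] {q : α}

/-- The rule `r` without the occurrences of `q`. -/
def Rule.without (q : α) (r : Rule α) : Rule α := ⟨r.headWo q, r.bodyWo q⟩

/-- Some rule of `S`, stripped of `q`, is violated in `⟨X, Y⟩`. -/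
def ViolatedWo (q : α) (X Y : Set α) (S : Program α) : Prop :=
  ∃ r ∈ S, (r.without q).Viol X Y

theorem violatedWo_union (X Y : Set α) (S T : Program α) :
    ViolatedWo q X Y (S ∪ T) ↔ ViolatedWo q X Y S ∨ ViolatedWo q X Y T := by
  simp only [ViolatedWo, Finset.mem_union]
  grind

theorem mem_bodyWo {r : Rule α} {l : Lit α} : l ∈ r.bodyWo q ↔ l ∈ r.body ∧ l.atom ≠ q := by
  cases l <;> simp [Rule.bodyWo, Lit.atom]

theorem mem_headWo {r : Rule α} {a : α} : a ∈ r.headWo q ↔ a ∈ r.head ∧ a ≠ q := by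
  simp [Rule.headWo]

theorem Rule.headWo_eq {r : Rule α} (h : q ∉ r.head) : r.headWo q = r.head := by
  ext a
  rw [mem_headWo]
  grind

theorem Rule.bodyWo_eq {r : Rule α} (hp : Lit.pos q ∉ r.body) (hn : Lit.neg q ∉ r.body)
    (hnn : Lit.nneg q ∉ r.body) : r.bodyWo q = r.body := by
  ext l
  rw [mem_bodyWo]
  refine and_iff_left_of_imp fun hl he => ?_
  cases l <;> simp only [Lit.atom] at he <;> subst he <;> contradiction

theorem Rule.mem_atoms {r : Rule α} : q ∈ r.atoms ↔
    q ∈ r.head ∨ Lit.pos q ∈ r.body ∨ Lit.neg q ∈ r.body ∨ Lit.nneg q ∈ r.body := by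
  simp only [Rule.atoms, Finset.mem_union, Finset.mem_image]
  refine or_congr_right ⟨?_, ?_⟩
  · rintro ⟨l, hl, rfl⟩
    cases l <;> simp [Lit.atom, hl]
  · rintro (h | h | h)
    exacts [⟨_, h, rfl⟩, ⟨_, h, rfl⟩, ⟨_, h, rfl⟩]

/-- Separates the part of a violation that ignores `q` from the conditions that `q` itself imposes,
so that one pair `⟨X, Y⟩` serves all placements of `q`. -/
theorem Rule.viol_iff_without {r : Rule α} {X Y X' Y' : Set α}
    (hX : ∀ a, a ≠ q → (a ∈ X' ↔ a ∈ X)) (hY : ∀ a, a ≠ q → (a ∈ Y' ↔ a ∈ Y)) :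
    r.Viol X' Y' ↔ (r.without q).Viol X Y ∧ (Lit.pos q ∈ r.body → q ∈ X') ∧
      (Lit.neg q ∈ r.body → q ∉ Y') ∧ (Lit.nneg q ∈ r.body → q ∈ Y') ∧
      (q ∈ r.head → q ∉ X') := by
  constructor
  · rintro ⟨hb, hh⟩
    refine ⟨⟨fun l hl => ?_, fun a ha => ?_⟩, hb _, hb _, hb _, hh q⟩
    · obtain ⟨hl, hq⟩ := mem_bodyWo.1 hl
      exact (Lit.holdsHT_congr (hX _ hq) (hY _ hq)).1 (hb l hl)
    · obtain ⟨ha, hq⟩ := mem_headWo.1 ha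
      exact fun h => hh a ha ((hX a hq).2 h)
  · rintro ⟨⟨hb, hh⟩, hp, hn, hnn, hq⟩
    refine ⟨fun l hl => ?_, fun a ha => ?_⟩
    · by_cases he : l.atom = q
      · cases l <;> simp only [Lit.atom] at he <;> subst he
        exacts [hp hl, hn hl, hnn hl]
      · exact (Lit.holdsHT_congr (hX _ he) (hY _ he)).2 (hb l (mem_bodyWo.2 ⟨hl, he⟩))
    · by_cases he : a = q
      · subst he
        exact hq ha
      · exact fun h => hh a (mem_headWo.2 ⟨ha, he⟩) ((hX a he).1 h)

/-- With `q` false in both components, `q` and `not not q` in a body disable the rule, while `not q`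
in a body and `q` in a head have no effect. -/
theorem violated_sdiff_sdiff {N : Program α} (hN : ∀ r ∈ N, r.Clean q) (X Y : Set α) :
    Violated (X \ {q}) (Y \ {q}) N ↔ ViolatedWo q X Y (clsR q N) ∨
      ViolatedWo q X Y (clsR1 q N ∪ clsR4 q N) := by
  simp only [Violated, ViolatedWo, clsR, clsR1, clsR4, Finset.mem_union, Finset.mem_filter,
    Rule.mem_atoms, ← exists_or]
  refine exists_congr fun r => ?_
  by_cases hr : r ∈ N
  · rw [Rule.viol_iff_without (X := X) (Y := Y) (q := q) (by simp +contextual)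
      (by simp +contextual)]
    have := (hN r hr).head_pos
    have := (hN r hr).pos_neg
    have := (hN r hr).neg_nneg
    simp [hr]
    tauto
  · simp [hr]

/-- With `q` only in the second component, `q` and `not q` in a body both fail, `not not q` holds,
and `q` in a head does not help to satisfy the rule. -/
theorem violated_sdiff_insert {N : Program α} (hN : ∀ r ∈ N, r.Clean q) (X Y : Set α) :
    Violated (X \ {q}) (insert q Y) N ↔ ViolatedWo q X Y (clsR q N) ∨
      ViolatedWo q X Y (clsR2 q N) ∨ ViolatedWo q X Y (clsR3 q N) ∨
      ViolatedWo q X Y (clsR4 q N) := by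
  simp only [Violated, ViolatedWo, clsR, clsR2, clsR3, clsR4, Finset.mem_filter,
    Rule.mem_atoms, ← exists_or]
  refine exists_congr fun r => ?_
  by_cases hr : r ∈ N
  · rw [Rule.viol_iff_without (X := X) (Y := Y) (q := q) (by simp +contextual)
      (by simp +contextual)]
    have := (hN r hr).head_pos
    have := (hN r hr).head_neg
    have := (hN r hr).pos_nneg
    have := (hN r hr).neg_nneg
    simp [hr]
    tauto
  · simp [hr]

/-- With `q` in both components, `q` in a head satisfies the rule and `not q` in a body disables it.
-/
theorem violated_insert_insert {N : Program α} (hN : ∀ r ∈ N, r.Clean q) (X Y : Set α) :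
    Violated (insert q X) (insert q Y) N ↔ ViolatedWo q X Y (clsR q N) ∨
      ViolatedWo q X Y (clsR0 q N) ∨ ViolatedWo q X Y (clsR2 q N) := by
  simp only [Violated, ViolatedWo, clsR, clsR0, clsR2, Finset.mem_filter,
    Rule.mem_atoms, ← exists_or]
  refine exists_congr fun r => ?_
  by_cases hr : r ∈ N
  · rw [Rule.viol_iff_without (X := X) (Y := Y) (q := q) (by simp +contextual)
      (by simp +contextual)]
    have := (hN r hr).head_pos
    have := (hN r hr).pos_neg
    have := (hN r hr).neg_nneg
    simp [hr]
    tauto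
  · simp [hr]

/-! ### Negated literals and the as-dual. -/

omit [DecidableEq α] in
theorem Lit.holdsHT_naf (X Y : Set α) (l : Lit α) : l.naf.HoldsHT X Y ↔ ¬ l.HoldsHT Y Y := by
  cases l <;> simp [Lit.naf, Lit.HoldsHT]

omit [DecidableEq α] in
theorem Lit.holdsHT_nafnaf (X Y : Set α) (l : Lit α) : l.nafnaf.HoldsHT X Y ↔ l.HoldsHT Y Y := by
  cases l <;> simp [Lit.nafnaf, Lit.HoldsHT]

theorem bodyHolds_nafSet (X Y : Set α) (S : Finset (Lit α)) :
    BodyHolds X Y (nafSet S) ↔ ∀ l ∈ S, ¬ l.HoldsHT Y Y := by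
  simp [BodyHolds, nafSet, Lit.holdsHT_naf]

theorem bodyHolds_nafSet_lits (X Y : Set α) (A : Finset α) :
    BodyHolds X Y (nafSet (lits A)) ↔ ∀ a ∈ A, a ∉ Y := by
  simp [bodyHolds_nafSet, lits, Lit.HoldsHT]

theorem bodyHolds_nafnafSet (X Y : Set α) (S : Finset (Lit α)) :
    BodyHolds X Y (nafnafSet S) ↔ BodyHolds Y Y S := by
  simp [BodyHolds, nafnafSet, Lit.holdsHT_nafnaf]

theorem bodyHolds_nafnafSet_lits (X Y : Set α) (A : Finset α) :
    BodyHolds X Y (nafnafSet (lits A)) ↔ ∀ a ∈ A, a ∈ Y := by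
  rw [bodyHolds_nafnafSet]
  simp [BodyHolds, lits, Lit.HoldsHT]

/-- The as-dual is a disjunctive normal form of the joint satisfaction of the stripped rules. -/
theorem exists_mem_asDual_bodyHolds (X Y : Set α) (S : Program α) :
    (∃ D ∈ asDual q S, BodyHolds X Y D) ↔ ¬ ViolatedWo q Y Y S := by
  classical
  simp only [asDual, Finset.mem_biUnion, Finset.mem_image, Finset.mem_powerset, Finset.mem_pi]
  constructor
  · rintro ⟨D, ⟨F, hF, b, hb, h, hh, rfl⟩, hD⟩ ⟨r, hr, hv⟩
    rw [bodyHolds_union, bodyHolds_nafSet, bodyHolds_nafnafSet_lits] at hD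
    by_cases hrF : r ∈ F
    · exact hD.1 (b r hrF) (Finset.mem_image.2 ⟨⟨r, hrF⟩, Finset.mem_attach _ _, rfl⟩)
        (hv.1 _ (hb r hrF))
    · have hrT : r ∈ S \ F := Finset.mem_sdiff.2 ⟨hr, hrF⟩
      exact hv.2 _ (hh r hrT)
        (hD.2 (h r hrT) (Finset.mem_image.2 ⟨⟨r, hrT⟩, Finset.mem_attach _ _, rfl⟩))
  · intro hv
    -- The partition puts into `F` the rules whose stripped body fails in `Y`; each other rule is
    -- satisfied in `Y` through a head atom.
    have hb : ∀ r ∈ S.filter (fun r => ¬ BodyHolds Y Y (r.bodyWo q)),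
        ∃ l ∈ r.bodyWo q, ¬ l.HoldsHT Y Y := by
      intro r hr
      simpa [BodyHolds] using (Finset.mem_filter.1 hr).2
    have hh : ∀ r ∈ S \ S.filter (fun r => ¬ BodyHolds Y Y (r.bodyWo q)),
        ∃ a ∈ r.headWo q, a ∈ Y := by
      intro r hr
      by_contra hc
      simp only [Finset.mem_sdiff, Finset.mem_filter, not_and, not_not] at hr
      exact hv ⟨r, hr.1, hr.2 hr.1, fun a ha haY => hc ⟨a, ha, haY⟩⟩
    choose b hb hb' using hb
    choose h hh hh' using hh
    refine ⟨_, ⟨_, Finset.filter_subset _ _, b, hb, h, hh, rfl⟩, ?_⟩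
    rw [bodyHolds_union, bodyHolds_nafSet, bodyHolds_nafnafSet_lits]
    simp only [Finset.mem_image, Finset.mem_attach, true_and]
    constructor
    · rintro _ ⟨r, rfl⟩
      exact hb' _ _
    · rintro _ ⟨r, rfl⟩
      exact hh' _ _

omit [DecidableEq α] in
theorem BodyHolds.mono {X X' Y : Set α} (h : X ⊆ X') {B : Finset (Lit α)}
    (hB : BodyHolds X Y B) : BodyHolds X' Y B := fun l hl => (hB l hl).mono h

/-- The elements of the as-dual that contradict a true body may be left out. -/
theorem exists_mem_asDual_filter_bodyHolds {X Y : Set α} (hXY : X ⊆ Y) (S : Program α)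
    {B : Finset (Lit α)} (hB : BodyHolds X Y B) :
    (∃ D ∈ (asDual q S).filter (fun D => D ∩ nafSet B = ∅), BodyHolds X Y D) ↔
      ¬ ViolatedWo q Y Y S := by
  rw [← exists_mem_asDual_bodyHolds X]
  refine ⟨fun ⟨D, hD, h⟩ => ⟨D, (Finset.mem_filter.1 hD).1, h⟩, fun ⟨D, hD, h⟩ =>
    ⟨D, Finset.mem_filter.2 ⟨hD, Finset.eq_empty_of_forall_notMem fun l hl => ?_⟩, h⟩⟩
  obtain ⟨hlD, hl⟩ := Finset.mem_inter.1 hl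
  obtain ⟨l, hlB, rfl⟩ := Finset.mem_image.1 hl
  exact (Lit.holdsHT_naf X Y l).1 (h _ hlD) ((hB l hlB).mono hXY)

theorem Rule.viol_without_iff {r : Rule α} {X Y : Set α} :
    (r.without q).Viol X Y ↔ BodyHolds X Y (r.bodyWo q) ∧ ∀ a ∈ r.headWo q, a ∉ X := Iff.rfl

/-- For a rule `r` of `S` that is violated in `⟨X, Y⟩`, its satisfaction in `Y` is witnessed by a
head atom in `Y`. -/
theorem exists_mem_asDual_sdiff {X Y : Set α} (hXY : X ⊆ Y) {S : Program α} {r : Rule α}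
    (hr : r ∈ S) (hB : BodyHolds X Y (r.bodyWo q)) :
    (∃ h ∈ r.headWo q, h ∈ Y ∧ ∃ D ∈ asDual q (S \ {r}), BodyHolds X Y D) ↔
      ¬ ViolatedWo q Y Y S := by
  simp only [exists_mem_asDual_bodyHolds]
  constructor
  · rintro ⟨h, hh, hY, hS⟩ ⟨s, hs, hv⟩
    by_cases he : s = r
    · subst he
      exact hv.2 h hh hY
    · exact hS ⟨s, by simp [hs, he], hv⟩
  · intro hS
    have : ∃ h ∈ r.headWo q, h ∈ Y := by
      by_contra hc
      exact hS ⟨r, hr, hB.mono hXY, fun a ha haY => hc ⟨a, ha, haY⟩⟩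
    obtain ⟨h, hh, hY⟩ := this
    exact ⟨h, hh, hY, fun ⟨s, hs, hv⟩ => hS ⟨s, (Finset.mem_sdiff.1 hs).1, hv⟩⟩

theorem violated_biUnion {ι : Type*} (S : Finset ι) (f : ι → Program α) (X Y : Set α) :
    Violated X Y (S.biUnion f) ↔ ∃ i ∈ S, Violated X Y (f i) := by
  simp only [Violated, Finset.mem_biUnion]
  grind

theorem violated_image {ι : Type*} (S : Finset ι) (f : ι → Rule α) (X Y : Set α) :
    Violated X Y (S.image f) ↔ ∃ i ∈ S, (f i).Viol X Y := by
  simp [Violated]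

omit [DecidableEq α] in
theorem Rule.viol_mk (H : Finset α) (B : Finset (Lit α)) (X Y : Set α) :
    (Rule.mk H B).Viol X Y ↔ BodyHolds X Y B ∧ ∀ a ∈ H, a ∉ X := Iff.rfl

theorem forall_mem_union_notMem (A B : Finset α) (X : Set α) :
    (∀ a ∈ A ∪ B, a ∉ X) ↔ (∀ a ∈ A, a ∉ X) ∧ ∀ a ∈ B, a ∉ X := by
  simp only [Finset.mem_union, or_imp, forall_and]

omit [DecidableEq α] in
theorem bodyHolds_singleton (X Y : Set α) (l : Lit α) :
    BodyHolds X Y {l} ↔ l.HoldsHT X Y := by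
  simp [BodyHolds]

omit [DecidableEq α] in
theorem Lit.holdsHT_pos (X Y : Set α) (a : α) : (Lit.pos a).HoldsHT X Y ↔ a ∈ X := Iff.rfl

omit [DecidableEq α] in
theorem Lit.holdsHT_nneg (X Y : Set α) (a : α) : (Lit.nneg a).HoldsHT X Y ↔ a ∈ Y := Iff.rfl

/-! ### When each family of derived rules is violated. -/

variable {N : Program α}

theorem head_eq_of_mem_clsR0 (hN : ∀ r ∈ N, r.Clean q) {r : Rule α} (hr : r ∈ clsR0 q N) :
    r.head = r.headWo q := by
  obtain ⟨hr, hq⟩ := Finset.mem_filter.1 hr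
  exact (Rule.headWo_eq fun h => (hN r hr).head_pos h hq).symm

theorem head_eq_of_mem_clsR2 {r : Rule α} (hr : r ∈ clsR2 q N) : r.head = r.headWo q :=
  (Rule.headWo_eq (Finset.mem_filter.1 hr).2.2).symm

theorem head_eq_of_mem_clsR0_union_clsR2 (hN : ∀ r ∈ N, r.Clean q) {r : Rule α}
    (hr : r ∈ clsR0 q N ∪ clsR2 q N) : r.head = r.headWo q :=
  (Finset.mem_union.1 hr).elim (head_eq_of_mem_clsR0 hN) head_eq_of_mem_clsR2

theorem body_eq_of_mem_clsR4 (hN : ∀ r ∈ N, r.Clean q) {r : Rule α} (hr : r ∈ clsR4 q N) :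
    r.body = r.bodyWo q := by
  obtain ⟨hr, hnn, hq⟩ := Finset.mem_filter.1 hr
  exact (Rule.bodyWo_eq ((hN r hr).head_pos hq) ((hN r hr).head_neg hq) hnn).symm

theorem violated_clsR (X Y : Set α) : Violated X Y (clsR q N) ↔ ViolatedWo q X Y (clsR q N) := by
  refine exists_congr fun r => and_congr_right fun hr => ?_
  have hq := (Finset.mem_filter.1 hr).2
  simp only [Rule.mem_atoms, not_or] at hq
  rw [Rule.viol_without_iff, Rule.headWo_eq hq.1, Rule.bodyWo_eq hq.2.1 hq.2.2.1 hq.2.2.2]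
  rfl

theorem violated_derive1a (hN : ∀ r ∈ N, r.Clean q) (X Y : Set α) :
    Violated X Y (derive1a q N) ↔
      ViolatedWo q X Y (clsR0 q N) ∧ ViolatedWo q X Y (clsR4 q N) := by
  simp only [derive1a, violated_biUnion, violated_image, Rule.viol_mk, bodyHolds_union,
    forall_mem_union_notMem, ViolatedWo, Rule.viol_without_iff]
  constructor
  · rintro ⟨r₀, h₀, r₄, h₄, hb, hh⟩
    rw [head_eq_of_mem_clsR0 hN h₀] at hh
    rw [body_eq_of_mem_clsR4 hN h₄] at hb
    exact ⟨⟨r₀, h₀, hb.1, hh.1⟩, r₄, h₄, hb.2, hh.2⟩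
  · rintro ⟨⟨r₀, h₀, hb₀, hh₀⟩, r₄, h₄, hb₄, hh₄⟩
    rw [← head_eq_of_mem_clsR0 hN h₀] at hh₀
    rw [← body_eq_of_mem_clsR4 hN h₄] at hb₄
    exact ⟨r₀, h₀, r₄, h₄, ⟨hb₀, hb₄⟩, hh₀, hh₄⟩

theorem violated_derive2a (hN : ∀ r ∈ N, r.Clean q) (X Y : Set α) :
    Violated X Y (derive2a q N) ↔
      ViolatedWo q X Y (clsR0 q N) ∧ ViolatedWo q X Y (clsR3 q N) ∧
        ViolatedWo q Y Y (clsR1 q N ∪ clsR4 q N) := by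
  simp only [derive2a, violated_biUnion, violated_image, Rule.viol_mk, bodyHolds_union,
    forall_mem_union_notMem, ViolatedWo, Rule.viol_without_iff, bodyHolds_nafSet_lits,
    bodyHolds_nafnafSet]
  constructor
  · rintro ⟨r₀, h₀, r₃, h₃, r', h', ⟨⟨⟨hb₀, hb₃⟩, hh'⟩, hb'⟩, hh₀, hh₃⟩
    rw [head_eq_of_mem_clsR0 hN h₀] at hh₀
    exact ⟨⟨r₀, h₀, hb₀, hh₀⟩, ⟨r₃, h₃, hb₃, hh₃⟩, r', h', hb', hh'⟩
  · rintro ⟨⟨r₀, h₀, hb₀, hh₀⟩, ⟨r₃, h₃, hb₃, hh₃⟩, r', h', hb', hh'⟩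
    rw [← head_eq_of_mem_clsR0 hN h₀] at hh₀
    exact ⟨r₀, h₀, r₃, h₃, r', h', ⟨⟨⟨hb₀, hb₃⟩, hh'⟩, hb'⟩, hh₀, hh₃⟩

/-- Here one and the same `r₃` has its body evaluated in `⟨X, Y⟩` and its head in `Y`, so the
condition does not split into `ViolatedWo` statements; the case of two distinct self-cycles is left
to `derive7`. -/
theorem violated_derive3a (hN : ∀ r ∈ N, r.Clean q) {X Y : Set α} (hXY : X ⊆ Y) :
    Violated X Y (derive3a q N) ↔
      ViolatedWo q X Y (clsR0 q N) ∧
        (∃ r₃ ∈ clsR3 q N, BodyHolds X Y (r₃.bodyWo q) ∧ ∀ a ∈ r₃.headWo q, a ∉ Y) ∧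
        ¬ ViolatedWo q Y Y (clsR0 q N ∪ clsR2 q N) := by
  simp only [derive3a, violated_biUnion, violated_image, Rule.viol_mk, bodyHolds_union,
    bodyHolds_nafSet_lits, bodyHolds_singleton, Lit.holdsHT_nneg]
  constructor
  · rintro ⟨r₀, h₀, r₃, h₃, h, hh, D, hD, ⟨⟨⟨⟨hb₀, hY⟩, hDh⟩, hb₃⟩, hh₃⟩, hh₀⟩
    rw [head_eq_of_mem_clsR0 hN h₀] at hh hh₀
    exact ⟨⟨r₀, h₀, hb₀, hh₀⟩, ⟨r₃, h₃, hb₃, hh₃⟩,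
      (exists_mem_asDual_sdiff hXY (Finset.mem_union_left _ h₀) hb₀).1
        ⟨h, hh, hY, D, hD, hDh⟩⟩
  · rintro ⟨⟨r₀, h₀, hb₀, hh₀⟩, ⟨r₃, h₃, hb₃, hh₃⟩, hS⟩
    obtain ⟨h, hh, hY, D, hD, hDh⟩ :=
      (exists_mem_asDual_sdiff hXY (Finset.mem_union_left _ h₀) hb₀).2 hS
    refine ⟨r₀, h₀, r₃, h₃, h, ?_, D, hD, ⟨⟨⟨⟨hb₀, hY⟩, hDh⟩, hb₃⟩, hh₃⟩, ?_⟩ <;>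
    rwa [head_eq_of_mem_clsR0 hN h₀]

theorem violated_derive1b (hN : ∀ r ∈ N, r.Clean q) (X Y : Set α) :
    Violated X Y (derive1b q N) ↔
      ViolatedWo q X Y (clsR2 q N) ∧ ViolatedWo q Y Y (clsR4 q N) := by
  simp only [derive1b, violated_biUnion, violated_image, Rule.viol_mk, bodyHolds_union,
    ViolatedWo, Rule.viol_without_iff, bodyHolds_nafSet_lits, bodyHolds_nafnafSet]
  constructor
  · rintro ⟨r₂, h₂, r₄, h₄, ⟨⟨hb₂, hh₄⟩, hb₄⟩, hh₂⟩
    rw [head_eq_of_mem_clsR2 h₂] at hh₂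
    rw [body_eq_of_mem_clsR4 hN h₄] at hb₄
    exact ⟨⟨r₂, h₂, hb₂, hh₂⟩, r₄, h₄, hb₄, hh₄⟩
  · rintro ⟨⟨r₂, h₂, hb₂, hh₂⟩, r₄, h₄, hb₄, hh₄⟩
    rw [← head_eq_of_mem_clsR2 h₂] at hh₂
    rw [← body_eq_of_mem_clsR4 hN h₄] at hb₄
    exact ⟨r₂, h₂, r₄, h₄, ⟨⟨hb₂, hh₄⟩, hb₄⟩, hh₂⟩

theorem violated_derive2b (X Y : Set α) :
    Violated X Y (derive2b q N) ↔
      ViolatedWo q X Y (clsR2 q N) ∧ ViolatedWo q Y Y (clsR3 q N) ∧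
        ViolatedWo q Y Y (clsR1 q N ∪ clsR4 q N) := by
  simp only [derive2b, violated_biUnion, violated_image, Rule.viol_mk, bodyHolds_union,
    forall_mem_union_notMem, ViolatedWo, Rule.viol_without_iff, bodyHolds_nafSet_lits,
    bodyHolds_nafnafSet]
  constructor
  · rintro ⟨r₂, h₂, r₃, h₃, r', h', ⟨⟨hb₂, hh₃, hh'⟩, hb₃, hb'⟩, hh₂⟩
    rw [head_eq_of_mem_clsR2 h₂] at hh₂
    exact ⟨⟨r₂, h₂, hb₂, hh₂⟩, ⟨r₃, h₃, hb₃, hh₃⟩, r', h', hb', hh'⟩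
  · rintro ⟨⟨r₂, h₂, hb₂, hh₂⟩, ⟨r₃, h₃, hb₃, hh₃⟩, r', h', hb', hh'⟩
    rw [← head_eq_of_mem_clsR2 h₂] at hh₂
    exact ⟨r₂, h₂, r₃, h₃, r', h', ⟨⟨hb₂, hh₃, hh'⟩, hb₃, hb'⟩, hh₂⟩

theorem violated_derive3b {X Y : Set α} (hXY : X ⊆ Y) :
    Violated X Y (derive3b q N) ↔
      ViolatedWo q X Y (clsR2 q N) ∧ ViolatedWo q Y Y (clsR3 q N) ∧
        ¬ ViolatedWo q Y Y (clsR0 q N ∪ clsR2 q N) := by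
  simp only [derive3b, violated_biUnion, violated_image, Rule.viol_mk, bodyHolds_union,
    bodyHolds_nafSet_lits, bodyHolds_nafnafSet, bodyHolds_singleton, Lit.holdsHT_pos]
  constructor
  · rintro ⟨r₂, h₂, r₃, h₃, h, hh, D, hD, ⟨⟨⟨hb₂, hh₃⟩, hb₃, hY⟩, hDh⟩, hh₂⟩
    rw [head_eq_of_mem_clsR2 h₂] at hh hh₂
    exact ⟨⟨r₂, h₂, hb₂, hh₂⟩, ⟨r₃, h₃, hb₃, hh₃⟩,
      (exists_mem_asDual_sdiff hXY (Finset.mem_union_right _ h₂) hb₂).1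
        ⟨h, hh, hY, D, hD, hDh⟩⟩
  · rintro ⟨⟨r₂, h₂, hb₂, hh₂⟩, ⟨r₃, h₃, hb₃, hh₃⟩, hS⟩
    obtain ⟨h, hh, hY, D, hD, hDh⟩ :=
      (exists_mem_asDual_sdiff hXY (Finset.mem_union_right _ h₂) hb₂).2 hS
    refine ⟨r₂, h₂, r₃, h₃, h, ?_, D, hD, ⟨⟨⟨hb₂, hh₃⟩, hb₃, hY⟩, hDh⟩, ?_⟩ <;>
    rwa [head_eq_of_mem_clsR2 h₂]

/-- The side condition on `D` is harmless: a `D` that negates a literal of the body of `r'` cannot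
hold together with that body. -/
theorem violated_derive4 {X Y : Set α} (hXY : X ⊆ Y) :
    Violated X Y (derive4 q N) ↔
      ViolatedWo q X Y (clsR1 q N ∪ clsR4 q N) ∧
        ¬ ViolatedWo q Y Y (clsR3 q N ∪ clsR4 q N) := by
  simp only [derive4, violated_biUnion, violated_image, Rule.viol_mk, bodyHolds_union]
  constructor
  · rintro ⟨r', h', D, hD, ⟨hb', hDh⟩, hh'⟩
    exact ⟨⟨r', h', hb', hh'⟩,
      (exists_mem_asDual_filter_bodyHolds hXY _ hb').1 ⟨D, hD, hDh⟩⟩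
  · rintro ⟨⟨r', h', hb', hh'⟩, hS⟩
    obtain ⟨D, hD, hDh⟩ := (exists_mem_asDual_filter_bodyHolds hXY _ hb').2 hS
    exact ⟨r', h', D, hD, ⟨hb', hDh⟩, hh'⟩

theorem violated_derive5 (hN : ∀ r ∈ N, r.Clean q) {X Y : Set α} (hXY : X ⊆ Y) :
    Violated X Y (derive5 q N) ↔
      ViolatedWo q X Y (clsR1 q N ∪ clsR4 q N) ∧ ViolatedWo q Y Y (clsR3 q N) ∧
        ViolatedWo q Y Y (clsR0 q N ∪ clsR2 q N) ∧ ¬ ViolatedWo q Y Y (clsR4 q N) := by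
  simp only [derive5, violated_biUnion, violated_image, Rule.viol_mk, bodyHolds_union,
    forall_mem_union_notMem, bodyHolds_nafSet_lits, bodyHolds_nafnafSet]
  constructor
  · rintro ⟨r', h', r₃, h₃, r, hr, D, hD, ⟨⟨⟨hb', hh, hh₃⟩, hb, hb₃⟩, hDh⟩, hh'⟩
    rw [head_eq_of_mem_clsR0_union_clsR2 hN hr] at hh
    exact ⟨⟨r', h', hb', hh'⟩, ⟨r₃, h₃, hb₃, hh₃⟩, ⟨r, hr, hb, hh⟩,
      (exists_mem_asDual_filter_bodyHolds hXY _ hb').1 ⟨D, hD, hDh⟩⟩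
  · rintro ⟨⟨r', h', hb', hh'⟩, ⟨r₃, h₃, hb₃, hh₃⟩, ⟨r, hr, hb, hh⟩, hS⟩
    obtain ⟨D, hD, hDh⟩ := (exists_mem_asDual_filter_bodyHolds hXY _ hb').2 hS
    refine ⟨r', h', r₃, h₃, r, hr, D, hD, ⟨⟨⟨hb', ?_, hh₃⟩, hb, hb₃⟩, hDh⟩, hh'⟩
    rwa [head_eq_of_mem_clsR0_union_clsR2 hN hr]

theorem violated_derive6 {X Y : Set α} (hXY : X ⊆ Y) :
    Violated X Y (derive6 q N) ↔
      ViolatedWo q X Y (clsR1 q N ∪ clsR4 q N) ∧ ViolatedWo q Y Y (clsR3 q N) ∧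
        ¬ ViolatedWo q Y Y (clsR1 q N ∪ clsR4 q N) := by
  simp only [derive6, violated_biUnion, violated_image, Rule.viol_mk, bodyHolds_union,
    bodyHolds_nafSet_lits, bodyHolds_nafnafSet, bodyHolds_singleton, Lit.holdsHT_pos]
  constructor
  · rintro ⟨r', h', r₃, h₃, h, hh, D, hD, ⟨⟨⟨hb', hh₃⟩, hb₃, hY⟩, hDh⟩, hh'⟩
    exact ⟨⟨r', h', hb', hh'⟩, ⟨r₃, h₃, hb₃, hh₃⟩,
      (exists_mem_asDual_sdiff hXY h' hb').1 ⟨h, hh, hY, D, hD, hDh⟩⟩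
  · rintro ⟨⟨r', h', hb', hh'⟩, ⟨r₃, h₃, hb₃, hh₃⟩, hS⟩
    obtain ⟨h, hh, hY, D, hD, hDh⟩ := (exists_mem_asDual_sdiff hXY h' hb').2 hS
    exact ⟨r', h', r₃, h₃, h, hh, D, hD, ⟨⟨⟨hb', hh₃⟩, hb₃, hY⟩, hDh⟩, hh'⟩

theorem violated_derive7 (hN : ∀ r ∈ N, r.Clean q) {X Y : Set α} (hXY : X ⊆ Y) :
    Violated X Y (derive7 q N) ↔
      ViolatedWo q X Y (clsR0 q N) ∧
        (∃ r₃ ∈ clsR3 q N, ∃ r₃' ∈ clsR3 q N, r₃' ≠ r₃ ∧ (r₃.without q).Viol X Y ∧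
          (r₃'.without q).Viol Y Y) ∧
        ¬ ViolatedWo q Y Y (clsR0 q N ∪ clsR2 q N) := by
  simp only [derive7, violated_biUnion, violated_image, Rule.viol_mk, bodyHolds_union,
    forall_mem_union_notMem, bodyHolds_nafSet_lits, bodyHolds_nafnafSet, bodyHolds_singleton,
    Lit.holdsHT_pos, Finset.mem_sdiff, Finset.mem_singleton]
  constructor
  · rintro ⟨r₀, h₀, r₃, h₃, r₃', ⟨h₃', hne⟩, h, hh, D, hD,
      ⟨⟨⟨⟨hb₀, hb₃⟩, hh₃'⟩, hb₃', hY⟩, hDh⟩, hh₀, hh₃⟩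
    rw [head_eq_of_mem_clsR0 hN h₀] at hh hh₀
    exact ⟨⟨r₀, h₀, hb₀, hh₀⟩, ⟨r₃, h₃, r₃', h₃', hne, ⟨hb₃, hh₃⟩, hb₃', hh₃'⟩,
      (exists_mem_asDual_sdiff hXY (Finset.mem_union_left _ h₀) hb₀).1
        ⟨h, hh, hY, D, hD, hDh⟩⟩
  · rintro ⟨⟨r₀, h₀, hb₀, hh₀⟩, ⟨r₃, h₃, r₃', h₃', hne, ⟨hb₃, hh₃⟩, hb₃', hh₃'⟩, hS⟩
    obtain ⟨h, hh, hY, D, hD, hDh⟩ :=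
      (exists_mem_asDual_sdiff hXY (Finset.mem_union_left _ h₀) hb₀).2 hS
    refine ⟨r₀, h₀, r₃, h₃, r₃', ⟨h₃', hne⟩, h, ?_, D, hD,
      ⟨⟨⟨⟨hb₀, hb₃⟩, hh₃'⟩, hb₃', hY⟩, hDh⟩, ?_, hh₃⟩ <;>
    rwa [head_eq_of_mem_clsR0 hN h₀]

/-- The rules (3a) and (7) together treat all pairs of self-cycles on `q`. -/
theorem violated_derive3a_or_derive7 (hN : ∀ r ∈ N, r.Clean q) {X Y : Set α} (hXY : X ⊆ Y) :
    Violated X Y (derive3a q N) ∨ Violated X Y (derive7 q N) ↔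
      ViolatedWo q X Y (clsR0 q N) ∧ ViolatedWo q X Y (clsR3 q N) ∧
        ViolatedWo q Y Y (clsR3 q N) ∧ ¬ ViolatedWo q Y Y (clsR0 q N ∪ clsR2 q N) := by
  rw [violated_derive3a hN hXY, violated_derive7 hN hXY]
  constructor
  · rintro (⟨h₀, ⟨r₃, h₃, hb, hh⟩, h⟩ | ⟨h₀, ⟨r₃, h₃, r₃', h₃', -, hv, hv'⟩, h⟩)
    · exact ⟨h₀, ⟨r₃, h₃, hb, fun a ha haX => hh a ha (hXY haX)⟩,
        ⟨r₃, h₃, hb.mono hXY, hh⟩, h⟩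
    · exact ⟨h₀, ⟨r₃, h₃, hv⟩, ⟨r₃', h₃', hv'⟩, h⟩
  · rintro ⟨h₀, ⟨r₃, h₃, hv⟩, ⟨r₃', h₃', hv'⟩, h⟩
    by_cases he : r₃' = r₃
    · subst he
      exact Or.inl ⟨h₀, ⟨r₃', h₃, hv.1, hv'.2⟩, h⟩
    · exact Or.inr ⟨h₀, ⟨r₃, h₃, r₃', h₃', he, hv, hv'⟩, h⟩

/-! ### The HT-models of the result of forgetting. -/

theorem violated_forgetSP (P : Program α) (q : α) {X Y : Set α} (hXY : X ⊆ Y) :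
    let N := normalForm P
    let V := fun Z => ViolatedWo q Z Y
    Violated X Y (forgetSP P q) ↔
      V X (clsR q N) ∨ (V X (clsR0 q N) ∧ V X (clsR4 q N)) ∨
      (V X (clsR0 q N) ∧ V X (clsR3 q N) ∧ V Y (clsR1 q N ∪ clsR4 q N)) ∨
      (V X (clsR0 q N) ∧ V X (clsR3 q N) ∧ V Y (clsR3 q N) ∧ ¬ V Y (clsR0 q N ∪ clsR2 q N)) ∨
      (V X (clsR2 q N) ∧ V Y (clsR4 q N)) ∨
      (V X (clsR2 q N) ∧ V Y (clsR3 q N) ∧ V Y (clsR1 q N ∪ clsR4 q N)) ∨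
      (V X (clsR2 q N) ∧ V Y (clsR3 q N) ∧ ¬ V Y (clsR0 q N ∪ clsR2 q N)) ∨
      (V X (clsR1 q N ∪ clsR4 q N) ∧ ¬ V Y (clsR3 q N ∪ clsR4 q N)) ∨
      (V X (clsR1 q N ∪ clsR4 q N) ∧ V Y (clsR3 q N) ∧ V Y (clsR0 q N ∪ clsR2 q N) ∧
        ¬ V Y (clsR4 q N)) ∨
      (V X (clsR1 q N ∪ clsR4 q N) ∧ V Y (clsR3 q N) ∧ ¬ V Y (clsR1 q N ∪ clsR4 q N)) := by
  intro N V
  have hN : ∀ r ∈ N, r.Clean q := fun r hr => Rule.clean_of_mem_normalForm hr q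
  simp only [forgetSP, violated_normalForm _ hXY, violated_union, V]
  rw [← violated_derive3a_or_derive7 hN hXY, ← violated_derive1a hN, ← violated_derive2a hN,
    ← violated_derive1b hN, ← violated_derive2b, ← violated_derive3b hXY, ← violated_derive4 hXY,
    ← violated_derive5 hN hXY, ← violated_derive6 hXY, ← violated_clsR]
  -- Only the order of the disjuncts differs: `derive7` comes last in the program but is paired with
  -- `derive3a` here.
  exact iff_of_eq (by ac_rfl)

/-- The HT-models of the result of forgetting `q`, in terms of the HT-models of the program: a set
`Y` without `q` is relevant if it is a model, or if `Y ∪ {q}` is one whose satisfaction depends on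
`q`; and `X` has to be compatible with both. -/
theorem isHTModel_forgetSP (P : Program α) (q : α) (X Y : Set α) :
    IsHTModel (forgetSP P q) X Y ↔ X ⊆ Y ∧
      (IsHTModel P (Y \ {q}) (Y \ {q}) ∨
        (IsHTModel P (insert q Y) (insert q Y) ∧ ¬ IsHTModel P (Y \ {q}) (insert q Y))) ∧
      (IsHTModel P (Y \ {q}) (Y \ {q}) → IsHTModel P (X \ {q}) (Y \ {q})) ∧
      (IsHTModel P (insert q Y) (insert q Y) ∧ ¬ IsHTModel P (Y \ {q}) (insert q Y) →
        IsHTModel P (X \ {q}) (insert q Y) ∨ IsHTModel P (insert q X) (insert q Y)) := by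
  have hN : ∀ r ∈ normalForm P, r.Clean q := fun r hr => Rule.clean_of_mem_normalForm hr q
  rw [isHTModel_iff]
  refine and_congr_right fun hXY => ?_
  have h1 : X \ {q} ⊆ Y \ {q} := Set.sdiff_subset_sdiff_left hXY
  have h2 : ∀ Z ⊆ Y, Z \ {q} ⊆ insert q Y := fun Z hZ a ha => Or.inr (hZ ha.1)
  have h3 : insert q X ⊆ insert q Y := Set.insert_subset_insert hXY
  simp only [← isHTModel_normalForm P, isHTModel_iff, violated_sdiff_sdiff hN,
    violated_sdiff_insert hN, violated_insert_insert hN, violated_forgetSP P q hXY,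
    violated_forgetSP P q (subset_refl Y), violatedWo_union, h1, h2 X hXY, h2 Y subset_rfl, h3,
    subset_rfl, true_and]
  -- No relation between violation in `⟨X, Y⟩` and in `⟨Y, Y⟩` is needed from here on: the
  -- equivalence holds for arbitrary truth values of the twelve propositions.
  generalize ViolatedWo q X Y (clsR q _) = a
  generalize ViolatedWo q X Y (clsR0 q _) = a0
  generalize ViolatedWo q X Y (clsR1 q _) = a1
  generalize ViolatedWo q X Y (clsR2 q _) = a2
  generalize ViolatedWo q X Y (clsR3 q _) = a3
  generalize ViolatedWo q X Y (clsR4 q _) = a4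
  generalize ViolatedWo q Y Y (clsR q _) = b
  generalize ViolatedWo q Y Y (clsR0 q _) = b0
  generalize ViolatedWo q Y Y (clsR1 q _) = b1
  generalize ViolatedWo q Y Y (clsR2 q _) = b2
  generalize ViolatedWo q Y Y (clsR3 q _) = b3
  generalize ViolatedWo q Y Y (clsR4 q _) = b4
  clear hN h1 h2 h3 hXY
  -- Fixing the six propositions about `Y` decides which of `Y \ {q}` and `insert q Y` are relevant,
  -- leaving a small condition on the six about `X`.
  by_cases b <;> by_cases b0 <;> by_cases b1 <;> by_cases b2 <;> by_cases b3 <;> by_cases b4 <;>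
    simp only [*] <;> grind

end ForgettingSemantics

end ASP

theorem mainTheorem5 {α : Type*} [DecidableEq α] (P P' : ASP.Program α) (q : α)
    (h : ASP.StronglyEquivalent P P') :
    ASP.StronglyEquivalent (ASP.forgetSP P q) (ASP.forgetSP P' q) := by
  rw [ASP.stronglyEquivalent_iff] at h ⊢
  intro X Y
  simp only [ASP.isHTModel_forgetSP, h]
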